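/- Let $Y$ be a real Banach space; "subspace" means closed linear subspace. A Banach space $Z$ is *octahedral* if for every $\varepsilon>0$ and every finite subset $A$ of its unit sphere $S_Z$ there is $z\in S_Z$ with $\|a-z\|\ge 2-\varepsilon$ for all $a\in A$. A subspace $X$ of $Y$ is an *almost isometric ideal* (ai-ideal) in $Y$ if for every $\varepsilon>0$ and every finite-dimensional subspace $E$ of $Y$ there is a linear operator $T:E\to X$ with $Te=e$ for all $e\in E\cap X$ and $(1-\varepsilon)\|e\|\le\|Te\|\le(1+\varepsilon)\|e\|$ for all $e\in E$. A Banach space *contains a copy of* $\ell_1$ if it has a subspace linearly homeomorphic to $\ell_1$. Then the following statements are equivalent: (a) $Y$ is octahedral. (b) Every separable ai-ideal in $Y$ is octahedral. (c) Every subspace $X$ of $Y$ for which the quotient $Y/X$ does not contain a copy of $\ell_1$ is octahedral. (d) Every subspace of finite codimension in $Y$ is octahedral. -/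

import Mathlib

/-- A normed space `Y` is octahedral if for every `ε > 0` and every finite subset `A` of its unit
sphere there is a `y` in the unit sphere such that `‖a - y‖ ≥ 2 - ε` for all `a ∈ A`. -/
def IsOctahedral (Y : Type*) [NormedAddCommGroup Y] : Prop :=
  ∀ ε : ℝ, 0 < ε → ∀ A : Finset Y, (∀ a ∈ A, ‖a‖ = 1) →
    ∃ y : Y, ‖y‖ = 1 ∧ ∀ a ∈ A, 2 - ε ≤ ‖a - y‖

/-- A subspace `X` of `Y` is an almost isometric ideal (ai-ideal) in `Y` if for every `ε > 0` and
every finite-dimensional subspace `E` of `Y` there is a linear operator `T : E → X` which is the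
identity on `E ∩ X` and satisfies `(1 - ε) ‖e‖ ≤ ‖T e‖ ≤ (1 + ε) ‖e‖` on `E`. -/
def IsAIIdeal {Y : Type*} [NormedAddCommGroup Y] [NormedSpace ℝ Y] (X : Submodule ℝ Y) : Prop :=
  ∀ ε : ℝ, 0 < ε → ∀ E : Submodule ℝ Y, FiniteDimensional ℝ E →
    ∃ T : E →ₗ[ℝ] X,
      (∀ e : E, (e : Y) ∈ X → (T e : Y) = (e : Y)) ∧
      ∀ e : E, (1 - ε) * ‖e‖ ≤ ‖T e‖ ∧ ‖T e‖ ≤ (1 + ε) * ‖e‖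

/-- `Z` contains a copy of `ℓ₁` if some linear subspace of `Z` is linearly homeomorphic to the
Banach space `ℓ₁` of absolutely summable real sequences. -/
def ContainsCopyOfL1 (Z : Type*) [SeminormedAddCommGroup Z] [NormedSpace ℝ Z] : Prop :=
  ∃ W : Submodule ℝ Z, Nonempty (lp (fun _ : ℕ => ℝ) 1 ≃L[ℝ] W)

/-!
(a) ⇒ (b): a unit vector `y` of `Y` at distance almost `2` from a finite subset of the unit sphere
of an ai-ideal `X` is carried into `X` by the almost isometry `T`, which fixes that finite set.

(a) ⇒ (c): iterating octahedrality produces a sequence which is almost isometrically equivalent to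
the basis of `ℓ₁` and almost `ℓ₁`-orthogonal to a given finite set. As `Y ⧸ X` contains no copy of
`ℓ₁`, the quotient map is not bounded below on the span of this sequence, so that some almost unit
vector of this span is close to a vector of `X`, which inherits the orthogonality.

(b) ⇒ (a): every finite set lies in a separable ai-ideal, by a Löwenheim–Skolem argument. Up to a
small error there are only countably many norms on a finite-dimensional space, so it takes a
separable extension of a separable subspace `W` to realize all the norms which finitely many vectors
of `Y` induce over finitely many vectors of `W`. Iterating this `ω` times and taking the closure
gives a separable space which realizes the norms over its own finite subsets.
-/

open TopologicalSpace
open scoped lp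

section Octahedral

variable {Y : Type*} [NormedAddCommGroup Y]

theorem isOctahedral_of_forall_finset_subset {R : Type*} [Ring R] [Module R Y]
    (h : ∀ A : Finset Y, ∃ X : Submodule R Y, (A : Set Y) ⊆ X ∧ IsOctahedral X) :
    IsOctahedral Y := by
  classical
  intro ε hε A hA
  obtain ⟨X, hAX, hX⟩ := h A
  obtain ⟨x, hx, hxA⟩ := hX ε hε (A.subtype (· ∈ X)) fun a ha => hA a (Finset.mem_subtype.1 ha)
  exact ⟨x, hx, fun a ha => hxA ⟨a, hAX ha⟩ (Finset.mem_subtype.2 ha)⟩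

theorem IsOctahedral.exists_of_isCompact (hY : IsOctahedral Y) {K : Set Y} (hK : IsCompact K)
    (hK_unit : ∀ a ∈ K, ‖a‖ = 1) {ε : ℝ} (hε : 0 < ε) :
    ∃ y : Y, ‖y‖ = 1 ∧ ∀ a ∈ K, 2 - ε ≤ ‖a - y‖ := by
  obtain ⟨N, hNK, hN_fin, hKN⟩ := hK.finite_cover_balls (half_pos hε)
  obtain ⟨y, hy, hyN⟩ := hY (ε / 2) (half_pos hε) hN_fin.toFinset fun a ha =>
    hK_unit a (hNK (hN_fin.mem_toFinset.1 ha))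
  refine ⟨y, hy, fun a ha => ?_⟩
  obtain ⟨b, hbN, hab⟩ := Set.mem_iUnion₂.1 (hKN ha)
  rw [Metric.mem_ball, dist_comm, dist_eq_norm] at hab
  linarith [hyN b (hN_fin.mem_toFinset.2 hbN), norm_sub_le_norm_sub_add_norm_sub b a y]

variable [NormedSpace ℝ Y]

theorem norm_sub_inv_norm_smul_self {w : Y} (hw : w ≠ 0) : ‖w - ‖w‖⁻¹ • w‖ = |‖w‖ - 1| := by
  calc ‖w - ‖w‖⁻¹ • w‖ = ‖(‖w‖ - 1) • (‖w‖⁻¹ • w)‖ := by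
        rw [sub_smul, one_smul, smul_inv_smul₀ (norm_ne_zero_iff.2 hw)]
    _ = |‖w‖ - 1| := by
        have hunit : ‖‖w‖⁻¹ • w‖ = 1 := norm_smul_inv_norm hw
        rw [norm_smul, hunit, mul_one, Real.norm_eq_abs]

theorem isOctahedral_of_forall_exists_almost_unit
    (h : ∀ δ : ℝ, 0 < δ → ∀ A : Finset Y, (∀ a ∈ A, ‖a‖ = 1) →
      ∃ w : Y, |‖w‖ - 1| ≤ δ ∧ ∀ a ∈ A, 2 - δ ≤ ‖a - w‖) : IsOctahedral Y := by
  intro ε hε A hA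
  obtain ⟨w, hw, hwA⟩ := h (min (ε / 2) (1 / 2)) (by positivity) A hA
  have hε_le := min_le_left (ε / 2) (1 / 2)
  have hw0 : w ≠ 0 := by
    rintro rfl
    norm_num at hw
  refine ⟨‖w‖⁻¹ • w, norm_smul_inv_norm hw0, fun a ha => ?_⟩
  have htri := norm_sub_le_norm_sub_add_norm_sub a (‖w‖⁻¹ • w) w
  rw [norm_sub_rev (‖w‖⁻¹ • w) w, norm_sub_inv_norm_smul_self hw0] at htri
  linarith [hwA a ha]

theorem IsOctahedral.of_isAIIdeal (hY : IsOctahedral Y) {X : Submodule ℝ Y} (hX : IsAIIdeal X) :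
    IsOctahedral X := by
  classical
  refine isOctahedral_of_forall_exists_almost_unit fun δ hδ A hA => ?_
  obtain ⟨y, hy, hyA⟩ := hY (δ / 3) (by positivity) (A.image Subtype.val) (by simpa using hA)
  let E := Submodule.span ℝ ((insert y (A.image Subtype.val) : Finset Y) : Set Y)
  have hyE : y ∈ E := Submodule.subset_span (Finset.mem_insert_self _ _)
  obtain ⟨T, hT_id, hT⟩ := hX (δ / 3) (by positivity) E inferInstance
  refine ⟨T ⟨y, hyE⟩, ?_, fun a ha => ?_⟩
  · obtain ⟨hlower, hupper⟩ : 1 - δ / 3 ≤ ‖T ⟨y, hyE⟩‖ ∧ ‖T ⟨y, hyE⟩‖ ≤ 1 + δ / 3 := by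
      simpa [hy] using hT ⟨y, hyE⟩
    exact abs_le.2 ⟨by linarith, by linarith⟩
  · have haA : (a : Y) ∈ A.image Subtype.val := Finset.mem_image_of_mem _ ha
    have haE : (a : Y) ∈ E := Submodule.subset_span (Finset.mem_insert_of_mem haA)
    have hTa : T ⟨a, haE⟩ = a := Subtype.ext (hT_id ⟨a, haE⟩ a.2)
    have hlower := (hT (⟨a, haE⟩ - ⟨y, hyE⟩)).1
    rw [map_sub, hTa, Submodule.coe_norm, Submodule.coe_sub] at hlower
    have hay : ‖(a : Y) - y‖ ≤ 2 := by
      have := norm_sub_le (a : Y) y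
      rw [hy, ← Submodule.coe_norm, hA a ha] at this
      linarith
    nlinarith [hyA a haA]

end Octahedral

section AlmostOrthogonal

variable {Y : Type*} [NormedAddCommGroup Y] [NormedSpace ℝ Y]

theorem one_sub_mul_add_le_norm_smul_add_smul {x y : Y} (hx : ‖x‖ = 1) (hy : ‖y‖ = 1) {ε : ℝ}
    (hε : 0 ≤ ε) (h : 2 - ε ≤ ‖x + y‖) {s t : ℝ} (hs : 0 ≤ s) (ht : 0 ≤ t) :
    (1 - ε) * (s + t) ≤ ‖s • x + t • y‖ := by
  wlog hts : t ≤ s generalizing x y s t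
  · rw [add_comm s, add_comm (s • x)]
    exact this hy hx (by rwa [add_comm]) ht hs (le_of_not_ge hts)
  have htri := norm_add_le (s • x + t • y) ((s - t) • y)
  rw [show s • x + t • y + (s - t) • y = s • (x + y) by module, norm_smul, norm_smul, hy,
    Real.norm_of_nonneg hs, Real.norm_of_nonneg (sub_nonneg.2 hts)] at htri
  linarith [mul_le_mul_of_nonneg_left h hs, mul_nonneg hε ht]

theorem IsOctahedral.exists_almost_orthogonal (hY : IsOctahedral Y) (F : Submodule ℝ Y)
    [FiniteDimensional ℝ F] {ε : ℝ} (hε : 0 < ε) :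
    ∃ y : Y, ‖y‖ = 1 ∧ ∀ f ∈ F, ∀ t : ℝ, (1 - ε) * (‖f‖ + |t|) ≤ ‖f + t • y‖ := by
  obtain ⟨y, hy, hyF⟩ := hY.exists_of_isCompact
    ((isCompact_sphere (0 : F) 1).image continuous_subtype_val) (by
      rintro _ ⟨a, ha, rfl⟩
      simpa using ha) hε
  have hadd : ∀ a ∈ F, ‖a‖ = 1 → 2 - ε ≤ ‖a + y‖ := fun a haF ha => by
    rw [← norm_neg, neg_add']
    exact hyF (-a) ⟨⟨-a, F.neg_mem haF⟩, by simpa using ha, rfl⟩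
  refine ⟨y, hy, fun f hf t => ?_⟩
  wlog ht : 0 ≤ t generalizing f t
  · have := this (-f) (F.neg_mem hf) (-t) (by linarith)
    rwa [norm_neg, abs_neg, neg_smul, ← neg_add, norm_neg] at this
  rw [abs_of_nonneg ht]
  obtain rfl | hf0 := eq_or_ne f 0
  · rw [norm_zero, zero_add, zero_add, norm_smul, hy, Real.norm_of_nonneg ht]
    nlinarith
  · have hunit : ‖‖f‖⁻¹ • f‖ = 1 := norm_smul_inv_norm hf0
    have := one_sub_mul_add_le_norm_smul_add_smul hunit hy hε.le
      (hadd _ (F.smul_mem _ hf) hunit) (norm_nonneg f) ht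
    rwa [smul_inv_smul₀ (norm_ne_zero_iff.2 hf0)] at this

theorem IsOctahedral.exists_seq_almost_orthogonal (hY : IsOctahedral Y) (A : Finset Y) {ε : ℕ → ℝ}
    (hε : ∀ n, 0 < ε n) :
    ∃ y : ℕ → Y, (∀ n, ‖y n‖ = 1) ∧ ∀ n, ∀ f ∈ Submodule.span ℝ (A ∪ y '' Set.Iio n), ∀ t : ℝ,
      (1 - ε n) * (‖f‖ + |t|) ≤ ‖f + t • y n‖ := by
  classical
  choose next hnext_unit hnext using fun (n : ℕ) (B : Finset Y) =>
    hY.exists_almost_orthogonal (Submodule.span ℝ (B : Set Y)) (hε n)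
  let B : ℕ → Finset Y := fun n => Nat.rec A (fun k S => insert (next k S) S) n
  have hB : ∀ n, SetLike.coe (B n) = (A : Set Y) ∪ (fun k => next k (B k)) '' Set.Iio n := by
    intro n
    induction n with
    | zero => simp [B]
    | succ n ih =>
      rw [← Order.succ_eq_add_one, Order.Iio_succ_eq_insert, Set.image_insert_eq,
        Set.union_insert, ← ih]
      exact Finset.coe_insert _ _
  exact ⟨fun n => next n (B n), fun n => hnext_unit n _, fun n f hf => hnext n _ f (hB n ▸ hf)⟩

theorem one_sub_sum_mul_le_norm_add_sum {A : Set Y} {y : ℕ → Y} (hy : ∀ n, ‖y n‖ = 1) {ε : ℕ → ℝ}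
    (hε : ∀ n, 0 ≤ ε n)
    (h : ∀ n, ∀ f ∈ Submodule.span ℝ (A ∪ y '' Set.Iio n), ∀ t : ℝ,
      (1 - ε n) * (‖f‖ + |t|) ≤ ‖f + t • y n‖)
    {a : Y} (ha : a ∈ A) (c : ℕ → ℝ) (n : ℕ) :
    (1 - ∑ i ∈ Finset.range n, ε i) * (‖a‖ + ∑ i ∈ Finset.range n, |c i|) ≤
      ‖a + ∑ i ∈ Finset.range n, c i • y i‖ := by
  induction n with
  | zero => simp
  | succ n ih =>
    simp only [Finset.sum_range_succ, ← add_assoc]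
    have hmem : a + ∑ i ∈ Finset.range n, c i • y i ∈ Submodule.span ℝ (A ∪ y '' Set.Iio n) :=
      add_mem (Submodule.subset_span (.inl ha)) <| sum_mem fun i hi =>
        Submodule.smul_mem _ _ (Submodule.subset_span (.inr ⟨i, Finset.mem_range.1 hi, rfl⟩))
    have hupper : ‖a + ∑ i ∈ Finset.range n, c i • y i‖ ≤ ‖a‖ + ∑ i ∈ Finset.range n, |c i| := by
      refine (norm_add_le _ _).trans (add_le_add_right ((norm_sum_le _ _).trans_eq ?_) _)
      simp only [norm_smul, hy, mul_one, Real.norm_eq_abs]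
    have hσ : 0 ≤ ∑ i ∈ Finset.range n, ε i := Finset.sum_nonneg fun i _ => hε i
    linarith [h n _ hmem (c n), mul_le_mul_of_nonneg_left hupper (hε n),
      mul_nonneg hσ (abs_nonneg (c n))]

theorem IsOctahedral.exists_seq_almost_l1 (hY : IsOctahedral Y) (A : Finset Y) {ε : ℝ}
    (hε : 0 < ε) :
    ∃ y : ℕ → Y, (∀ n, ‖y n‖ = 1) ∧ ∀ a ∈ A, ∀ (c : ℕ → ℝ) (n : ℕ),
      (1 - ε) * (‖a‖ + ∑ i ∈ Finset.range n, |c i|) ≤ ‖a + ∑ i ∈ Finset.range n, c i • y i‖ := by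
  have hε_pos : ∀ n : ℕ, 0 < ε / 2 * (1 / 2) ^ n := fun n => by positivity
  obtain ⟨y, hy, hyA⟩ := hY.exists_seq_almost_orthogonal A hε_pos
  refine ⟨y, hy, fun a ha c n => le_trans ?_
    (one_sub_sum_mul_le_norm_add_sum hy (fun n => (hε_pos n).le) hyA ha c n)⟩
  rw [← Finset.mul_sum]
  gcongr
  linarith [mul_le_mul_of_nonneg_left (sum_geometric_two_le n) (half_pos hε).le]

end AlmostOrthogonal

section CopyOfL1

variable {Y : Type*} [NormedAddCommGroup Y] [NormedSpace ℝ Y]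
  {Z : Type*} [SeminormedAddCommGroup Z] [NormedSpace ℝ Z]

theorem hasSum_abs_lpOne (c : ℓ¹(ℕ, ℝ)) : HasSum (fun i => |c i|) ‖c‖ := by
  simpa using lp.hasSum_norm (p := 1) (by simp) c

theorem exists_lpOne_operator_hasSum [CompleteSpace Y] {y : ℕ → Y} (hy : ∀ n, ‖y n‖ ≤ 1) :
    ∃ T : ℓ¹(ℕ, ℝ) →L[ℝ] Y, (∀ c, ‖T c‖ ≤ ‖c‖) ∧ ∀ c, HasSum (fun i => c i • y i) (T c) := by
  let M : ℓ¹(ℕ, ℝ) →L[ℝ] ℓ¹(ℕ, Y) :=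
    lp.mapCLM 1 (fun i => ContinuousLinearMap.toSpanSingleton ℝ (y i)) zero_le_one
      (by simpa using hy)
  refine ⟨lp.tsumCLM ℝ ℕ Y ∘L M, fun c => ?_, fun c => ?_⟩
  · exact (lp.norm_tsum_le (M c)).trans
      (((lp.norm_mapCLM_le 1 _ zero_le_one _).trans' le_rfl |> M.le_of_opNorm_le <| c).trans_eq
        (one_mul _))
  · have hM : Summable fun i => ‖c i • y i‖ := by
      simpa [M] using (lp.memℓp (M c)).summable (by simp)
    exact hM.of_norm.hasSum

theorem IsOctahedral.exists_lpOne_operator [CompleteSpace Y] (hY : IsOctahedral Y) (A : Finset Y)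
    {ε : ℝ} (hε : 0 < ε) :
    ∃ T : ℓ¹(ℕ, ℝ) →L[ℝ] Y, (∀ c, ‖T c‖ ≤ ‖c‖) ∧
      ∀ a ∈ A, ∀ c, (1 - ε) * (‖a‖ + ‖c‖) ≤ ‖a + T c‖ := by
  obtain ⟨y, hy, hyA⟩ := hY.exists_seq_almost_l1 A hε
  obtain ⟨T, hT_le, hT⟩ := exists_lpOne_operator_hasSum fun n => (hy n).le
  refine ⟨T, hT_le, fun a ha c => ?_⟩
  exact le_of_tendsto_of_tendsto'
    (((hasSum_abs_lpOne c).tendsto_sum_nat.const_add ‖a‖).const_mul (1 - ε))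
    ((hT c).tendsto_sum_nat.const_add a).norm (hyA a ha c)

theorem containsCopyOfL1_of_bounded_below (T : ℓ¹(ℕ, ℝ) →L[ℝ] Z) {δ : ℝ} (hδ : 0 < δ)
    (h : ∀ c, δ * ‖c‖ ≤ ‖T c‖) : ContainsCopyOfL1 Z := by
  have hle : ∀ c, ‖c‖ ≤ δ⁻¹ * ‖T c‖ := fun c => (le_inv_mul_iff₀ hδ).2 (h c)
  have hinj : Function.Injective T.toLinearMap :=
    (T.antilipschitz_of_bound (K := ⟨δ⁻¹, (inv_pos.2 hδ).le⟩) hle).injective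
  let e := LinearEquiv.ofInjective T.toLinearMap hinj
  refine ⟨_, ⟨e.toContinuousLinearEquivOfBounds ‖T‖ δ⁻¹ T.le_opNorm fun w => ?_⟩⟩
  obtain ⟨c, rfl⟩ := e.surjective w
  rw [e.symm_apply_apply]
  exact hle c

theorem exists_norm_sub_lt_of_not_containsCopyOfL1_quotient {X : Submodule ℝ Y}
    (hX : ¬ ContainsCopyOfL1 (Y ⧸ X)) (T : ℓ¹(ℕ, ℝ) →L[ℝ] Y) {δ : ℝ} (hδ : 0 < δ) :
    ∃ c, ‖c‖ = 1 ∧ ∃ x ∈ X, ‖T c - x‖ < δ := by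
  obtain ⟨c, hc⟩ : ∃ c, ‖X.mkQL (T c)‖ < δ * ‖c‖ := by
    by_contra! hcon
    exact hX (containsCopyOfL1_of_bounded_below (X.mkQL ∘L T) hδ hcon)
  have hc0 : 0 < ‖c‖ := pos_of_mul_pos_right ((norm_nonneg _).trans_lt hc) hδ.le
  obtain ⟨m, hm, hm_lt⟩ := Submodule.Quotient.norm_mk_lt (X.mkQL (T c)) (sub_pos.2 hc)
  rw [add_sub_cancel] at hm_lt
  have hmX : T c - m ∈ X := (Submodule.Quotient.eq X).1 hm.symm
  refine ⟨‖c‖⁻¹ • c, norm_smul_inv_norm (norm_pos_iff.1 hc0), ‖c‖⁻¹ • (T c - m),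
    X.smul_mem _ hmX, ?_⟩
  rwa [map_smul, ← smul_sub, sub_sub_cancel, norm_smul, norm_inv, norm_norm, inv_mul_lt_iff₀ hc0,
    mul_comm]

theorem IsOctahedral.of_not_containsCopyOfL1_quotient [CompleteSpace Y] (hY : IsOctahedral Y)
    {X : Submodule ℝ Y} (hX : ¬ ContainsCopyOfL1 (Y ⧸ X)) : IsOctahedral X := by
  classical
  refine isOctahedral_of_forall_exists_almost_unit fun δ hδ A hA => ?_
  -- The vector `0` is inserted so that `T` itself is bounded below.
  obtain ⟨T, hT_le, hT⟩ := hY.exists_lpOne_operator (insert 0 (A.image Subtype.val))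
    (ε := δ / 3) (by positivity)
  obtain ⟨c, hc, x, hx, hxT⟩ :=
    exists_norm_sub_lt_of_not_containsCopyOfL1_quotient hX T (δ := δ / 3) (by positivity)
  refine ⟨⟨-x, X.neg_mem hx⟩, ?_, fun a ha => ?_⟩
  · have hTc_le := hT_le c
    have hle_Tc := hT 0 (Finset.mem_insert_self _ _) c
    rw [norm_zero, zero_add, zero_add, hc] at hle_Tc
    have hdiff := abs_le.1 ((abs_norm_sub_norm_le (T c) x).trans hxT.le)
    rw [Submodule.coe_norm, norm_neg]
    exact abs_le.2 ⟨by linarith, by linarith⟩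
  · have hle := hT a (Finset.mem_insert_of_mem (Finset.mem_image_of_mem _ ha)) c
    rw [← Submodule.coe_norm, hA a ha, hc] at hle
    have htri := norm_add_le ((a : Y) + x) (T c - x)
    rw [add_add_sub_cancel] at htri
    rw [Submodule.coe_norm, Submodule.coe_sub, sub_neg_eq_add]
    linarith

theorem not_finiteDimensional_lpOne : ¬ FiniteDimensional ℝ ℓ¹(ℕ, ℝ) := by
  intro _
  have hli : LinearIndependent ℝ fun n : ℕ => (lp.single 1 n 1 : ℓ¹(ℕ, ℝ)) := by
    refine LinearIndependent.of_comp (LinearMap.pi (lp.evalₗ (𝕜 := ℝ) (fun _ : ℕ => ℝ) 1)) ?_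
    have hcomp : LinearMap.pi (lp.evalₗ (𝕜 := ℝ) (fun _ : ℕ => ℝ) 1) ∘ (fun n => lp.single 1 n 1) =
        fun n => Pi.single n 1 := funext fun n => lp.coeFn_single 1 n 1
    rw [hcomp]
    exact Pi.linearIndependent_single_one ℕ ℝ
  exact not_finite_iff_infinite.2 inferInstance hli.finite

theorem not_containsCopyOfL1_of_finiteDimensional [FiniteDimensional ℝ Z] :
    ¬ ContainsCopyOfL1 Z := by
  rintro ⟨W, ⟨e⟩⟩
  exact not_finiteDimensional_lpOne (LinearEquiv.finiteDimensional e.symm.toLinearEquiv)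

end CopyOfL1

section NormClose

variable {K L Y : Type*} [NormedAddCommGroup K] [NormedSpace ℝ K]
  [NormedAddCommGroup L] [NormedSpace ℝ L] [NormedAddCommGroup Y] [NormedSpace ℝ Y]

/-- Two operators on `K` are `δ`-norm-close if the seminorms `‖f ·‖` and `‖g ·‖` which they induce
on `K` differ by at most `δ ‖·‖`. The operators themselves may be far apart. -/
def NormClose (δ : ℝ) (f g : K →L[ℝ] Y) : Prop :=
  ∀ c, |‖f c‖ - ‖g c‖| ≤ δ * ‖c‖

namespace NormClose

variable {f g h : K →L[ℝ] Y} {δ η : ℝ}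

theorem of_norm_sub_le (hfg : ‖f - g‖ ≤ δ) : NormClose δ f g := fun c =>
  (abs_norm_sub_norm_le _ _).trans ((f - g).le_of_opNorm_le hfg c)

theorem symm (hfg : NormClose δ f g) : NormClose δ g f := fun c =>
  abs_sub_comm ‖f c‖ ‖g c‖ ▸ hfg c

theorem trans (hfg : NormClose δ f g) (hgh : NormClose η g h) : NormClose (δ + η) f h := fun c =>
  (abs_sub_le _ _ _).trans ((add_le_add (hfg c) (hgh c)).trans_eq (add_mul _ _ _).symm)

theorem coprod_of_norm_sub_le {f' : L →L[ℝ] Y} (hf : ‖f - g‖ ≤ δ) :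
    NormClose δ (f.coprod f') (g.coprod f') := by
  have hδ : 0 ≤ δ := (norm_nonneg _).trans hf
  refine of_norm_sub_le (ContinuousLinearMap.opNorm_le_bound _ hδ fun c => ?_)
  have hsub : (f.coprod f' - g.coprod f') c = (f - g) c.1 := by simp
  rw [hsub]
  exact ((f - g).le_of_opNorm_le hf _).trans
    (mul_le_mul_of_nonneg_left (norm_fst_le c) hδ)

end NormClose

/-- The seminorm `‖f ·‖` induced by an operator `f` on `K`, as an element of the space of
continuous functions on the unit ball; this space is separable when `K` is finite-dimensional. -/
def normOnBall (f : K →L[ℝ] Y) : C(Metric.closedBall (0 : K) 1, ℝ) where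
  toFun c := ‖f c‖

theorem normClose_of_dist_normOnBall_le [ProperSpace K] {f g : K →L[ℝ] Y} {δ : ℝ}
    (h : dist (normOnBall f) (normOnBall g) ≤ δ) : NormClose δ f g := by
  intro c
  obtain rfl | hc := eq_or_ne c 0
  · simp
  have hc0 : 0 < ‖c‖ := norm_pos_iff.2 hc
  have hmem : ‖c‖⁻¹ • c ∈ Metric.closedBall (0 : K) 1 :=
    mem_closedBall_zero_iff.2 (norm_smul_inv_norm hc).le
  have hball : |‖f (‖c‖⁻¹ • c)‖ - ‖g (‖c‖⁻¹ • c)‖| ≤ δ :=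
    (ContinuousMap.dist_apply_le_dist ⟨_, hmem⟩).trans h
  rwa [map_smul, map_smul, norm_smul, norm_smul, norm_inv, norm_norm, ← mul_sub, abs_mul,
    abs_of_pos (inv_pos.2 hc0), inv_mul_le_iff₀ hc0, mul_comm] at hball

end NormClose

section SeparableAIIdeal

variable {Y : Type*} [NormedAddCommGroup Y] [NormedSpace ℝ Y]

/-- `X` realizes norms over `W` if every finite system `g` of vectors of `Y` has copies `h` in `X`
whose linear combinations with a given finite system `f` in `W` have almost the same norms.
Systems of `n` vectors are encoded as operators on `Fin n → ℝ`. -/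
def RealizesNormsOver (W X : Submodule ℝ Y) : Prop :=
  ∀ ⦃n m : ℕ⦄ (f : (Fin n → ℝ) →L[ℝ] W) (g : (Fin m → ℝ) →L[ℝ] Y) ⦃δ : ℝ⦄, 0 < δ →
    ∃ h : (Fin m → ℝ) →L[ℝ] X,
      NormClose δ ((W.subtypeL ∘L f).coprod (X.subtypeL ∘L h)) ((W.subtypeL ∘L f).coprod g)

theorem exists_countable_forall_dist_lt {α M : Type*} [PseudoMetricSpace M] [SeparableSpace M]
    (Φ : α → M) : ∃ C : Set α, C.Countable ∧ ∀ a, ∀ δ > 0, ∃ b ∈ C, dist (Φ a) (Φ b) < δ := by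
  obtain ⟨t, ht, ht_count, ht_dense⟩ :=
    (IsSeparable.of_separableSpace (Set.range Φ)).exists_countable_dense_subset
  have := ht_count.to_subtype
  choose g hg using ht
  refine ⟨Set.range fun b : t => g b.2, Set.countable_range _, fun a δ hδ => ?_⟩
  obtain ⟨b, hb, hab⟩ := Metric.mem_closure_iff.1 (ht_dense (Set.mem_range_self a)) δ hδ
  exact ⟨g hb, ⟨⟨b, hb⟩, rfl⟩, by rwa [hg hb]⟩

theorem exists_isSeparable_realizesNormsOver (W : Submodule ℝ Y) (hW : IsSeparable (W : Set Y)) :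
    ∃ X : Submodule ℝ Y, W ≤ X ∧ IsSeparable (X : Set Y) ∧ RealizesNormsOver W X := by
  have := hW.secondCountableTopology
  choose C hC_count hC using fun n m : ℕ => exists_countable_forall_dist_lt
    fun p : ((Fin n → ℝ) →L[ℝ] W) × ((Fin m → ℝ) →L[ℝ] Y) =>
      (p.1, normOnBall ((W.subtypeL ∘L p.1).coprod p.2))
  let S : Set Y := W ∪ ⋃ (n : ℕ) (m : ℕ), ⋃ p ∈ C n m, Set.range p.2
  have hS : IsSeparable S := by
    refine hW.union (.iUnion fun n => .iUnion fun m => ?_)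
    have := (hC_count n m).to_subtype
    rw [Set.biUnion_eq_iUnion]
    exact .iUnion fun p => isSeparable_range p.1.2.continuous
  refine ⟨Submodule.span ℝ S, fun w hw => Submodule.subset_span (.inl hw), hS.span, ?_⟩
  intro n m f g δ hδ
  obtain ⟨⟨f', g'⟩, hb, hdist⟩ := hC n m (f, g) (δ / 2) (half_pos hδ)
  rw [Prod.dist_eq, max_lt_iff] at hdist
  obtain ⟨hf, hnorm⟩ := hdist
  have hg' : ∀ c, g' c ∈ Submodule.span ℝ S := fun c => Submodule.subset_span <| .inr <|
    Set.mem_iUnion₂.2 ⟨n, m, Set.mem_iUnion₂.2 ⟨_, hb, c, rfl⟩⟩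
  have hff' : ‖W.subtypeL ∘L f - W.subtypeL ∘L f'‖ ≤ δ / 2 := by
    rw [← ContinuousLinearMap.comp_sub]
    refine W.subtypeₗᵢ.norm_toContinuousLinearMap_comp.trans_le ?_
    exact (dist_eq_norm f f').symm.trans_le hf.le
  refine ⟨g'.codRestrict _ hg', ?_⟩
  rw [← add_halves δ]
  exact (NormClose.coprod_of_norm_sub_le hff').trans (normClose_of_dist_normOnBall_le hnorm.le).symm

theorem exists_norm_sub_lt_of_mem_closure_iSup {V : ℕ → Submodule ℝ Y} (hV : Monotone V) {n : ℕ}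
    {f : (Fin n → ℝ) →L[ℝ] Y} (hf : ∀ c, f c ∈ (⨆ k, V k).topologicalClosure) {δ : ℝ}
    (hδ : 0 < δ) : ∃ k, ∃ f' : (Fin n → ℝ) →L[ℝ] V k, ‖f - (V k).subtypeL ∘L f'‖ < δ := by
  let e := ContinuousLinearEquiv.piRing (𝕜 := ℝ) (E := Y) (Fin n)
  have hmem : e f ∈ closure (Set.univ.pi fun _ => ⋃ k, (V k : Set Y)) := by
    rw [closure_pi_set, ← Submodule.coe_iSup_of_directed V hV.directed_le]
    exact fun i _ => hf _
  have hopen : IsOpen (e.symm ⁻¹' Metric.ball f δ) := Metric.isOpen_ball.preimage e.symm.continuous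
  obtain ⟨v, hvf, hvV⟩ := mem_closure_iff.1 hmem _ hopen (by simpa using hδ)
  choose k hk using fun i => Set.mem_iUnion.1 (hvV i (Set.mem_univ i))
  have hv_coe : ∀ c, e.symm v c = ∑ i, c i • v i := LinearEquiv.piRing_symm_apply ℝ v
  have hv_mem : ∀ c, e.symm v c ∈ V (Finset.univ.sup k) := fun c => hv_coe c ▸
    sum_mem fun i hi => Submodule.smul_mem _ _ (hV (Finset.le_sup hi) (hk i))
  refine ⟨_, (e.symm v).codRestrict _ hv_mem, ?_⟩
  rw [← dist_eq_norm, dist_comm]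
  exact hvf

theorem realizesNormsOver_closure_iSup {V : ℕ → Submodule ℝ Y} (hV : Monotone V)
    (h : ∀ k, RealizesNormsOver (V k) (V (k + 1))) :
    RealizesNormsOver (⨆ k, V k).topologicalClosure (⨆ k, V k).topologicalClosure := by
  set X := (⨆ k, V k).topologicalClosure
  intro n m f g δ hδ
  obtain ⟨k, f', hf'⟩ := exists_norm_sub_lt_of_mem_closure_iSup hV
    (f := X.subtypeL ∘L f) (fun c => (f c).2) (δ := δ / 3) (by positivity)
  obtain ⟨g', hg'⟩ := h k f' g (δ := δ / 3) (by positivity)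
  have hVX : V (k + 1) ≤ X := (le_iSup V _).trans (Submodule.le_topologicalClosure _)
  refine ⟨((V (k + 1)).subtypeL ∘L g').codRestrict X fun c => hVX (g' c).2, ?_⟩
  rw [← add_thirds δ]
  exact ((NormClose.coprod_of_norm_sub_le hf'.le).trans hg').trans
    (NormClose.coprod_of_norm_sub_le hf'.le).symm

theorem exists_isSeparable_realizesNormsOver_self (W : Submodule ℝ Y)
    (hW : IsSeparable (W : Set Y)) :
    ∃ X : Submodule ℝ Y, W ≤ X ∧ IsClosed (X : Set Y) ∧ IsSeparable (X : Set Y) ∧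
      RealizesNormsOver X X := by
  choose! next hle_next hnext_sep hnext using exists_isSeparable_realizesNormsOver (Y := Y)
  let V : ℕ → Submodule ℝ Y := fun k => next^[k] W
  have hV_succ : ∀ k, V (k + 1) = next (V k) := fun k => Function.iterate_succ_apply' next k W
  have hV_sep : ∀ k, IsSeparable (V k : Set Y) := fun k => by
    induction k with
    | zero => exact hW
    | succ k ih => exact hV_succ k ▸ hnext_sep _ ih
  have hV : Monotone V := monotone_nat_of_le_succ fun k => hV_succ k ▸ hle_next _ (hV_sep k)
  refine ⟨(⨆ k, V k).topologicalClosure, (le_iSup V 0).trans (Submodule.le_topologicalClosure _),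
    Submodule.isClosed_topologicalClosure _, ?_,
    realizesNormsOver_closure_iSup hV fun k => hV_succ k ▸ hnext _ (hV_sep k)⟩
  rw [Submodule.topologicalClosure_coe, Submodule.coe_iSup_of_directed V hV.directed_le]
  exact (IsSeparable.iUnion hV_sep).closure

theorem exists_coordinates_of_finiteDimensional (X E : Submodule ℝ Y) [FiniteDimensional ℝ E] :
    ∃ (n m : ℕ) (e : E →L[ℝ] (Fin n → ℝ) × (Fin m → ℝ)) (f : (Fin n → ℝ) →L[ℝ] X)
      (g : (Fin m → ℝ) →L[ℝ] Y), (∀ v, f (e v).1 + g (e v).2 = (v : Y)) ∧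
        ∀ v : E, (v : Y) ∈ X → (e v).2 = 0 := by
  let B : Submodule ℝ E := X.comap E.subtype
  obtain ⟨C, hBC⟩ := B.exists_isCompl
  let b := (Module.finBasis ℝ B).equivFun
  let c := (Module.finBasis ℝ C).equivFun
  let e := (B.prodEquivOfIsCompl C hBC).symm ≪≫ₗ b.prodCongr c
  let f := E.subtype.restrict (p := B) (q := X) (fun _ hv => hv) ∘ₗ b.symm.toLinearMap
  let g := E.subtype ∘ₗ C.subtype ∘ₗ c.symm.toLinearMap
  refine ⟨_, _, e.toLinearMap.toContinuousLinearMap, f.toContinuousLinearMap,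
    g.toContinuousLinearMap, fun v => ?_, fun v hv => ?_⟩
  · have := congrArg Subtype.val ((B.prodEquivOfIsCompl C hBC).apply_symm_apply v)
    simpa [e, f, g] using this
  · have : ((B.prodEquivOfIsCompl C hBC).symm v).2 = 0 :=
      (B.prodEquivOfIsCompl_symm_apply_snd_eq_zero C hBC).2 hv
    simpa [e] using this

theorem RealizesNormsOver.isAIIdeal {X : Submodule ℝ Y} (hX : RealizesNormsOver X X) :
    IsAIIdeal X := by
  intro ε hε E _
  obtain ⟨n, m, e, f, g, hfg, he⟩ := exists_coordinates_of_finiteDimensional X E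
  obtain ⟨h, hh⟩ := hX f g (δ := ε / (‖e‖ + 1)) (by positivity)
  refine ⟨(f.coprod h ∘L e).toLinearMap, fun v hv => ?_, fun v => ?_⟩
  · have hfv := hfg v
    rw [he v hv, map_zero, add_zero] at hfv
    simp [he v hv, hfv]
  · have hclose : |‖(f.coprod h) (e v)‖ - ‖v‖| ≤ ε / (‖e‖ + 1) * ‖e v‖ := by
      simpa [hfg] using hh (e v)
    have hle : ε / (‖e‖ + 1) * ‖e v‖ ≤ ε * ‖v‖ := by
      rw [div_mul_eq_mul_div, div_le_iff₀ (by positivity), mul_assoc, mul_comm ‖v‖]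
      gcongr
      exact e.le_of_opNorm_le (le_add_of_nonneg_right zero_le_one) v
    have hbounds := abs_le.1 (hclose.trans hle)
    change (1 - ε) * ‖v‖ ≤ ‖(f.coprod h) (e v)‖ ∧ ‖(f.coprod h) (e v)‖ ≤ (1 + ε) * ‖v‖
    constructor <;> linarith [hbounds.1, hbounds.2]

theorem exists_separable_isAIIdeal (W : Submodule ℝ Y) (hW : IsSeparable (W : Set Y)) :
    ∃ X : Submodule ℝ Y, W ≤ X ∧ IsClosed (X : Set Y) ∧ SeparableSpace X ∧ IsAIIdeal X := by
  obtain ⟨X, hWX, hX_closed, hX_sep, hX⟩ := exists_isSeparable_realizesNormsOver_self W hW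
  exact ⟨X, hWX, hX_closed, hX_sep.separableSpace, hX.isAIIdeal⟩

end SeparableAIIdeal

theorem mainTheorem5 {Y : Type*} [NormedAddCommGroup Y] [NormedSpace ℝ Y] [CompleteSpace Y] :
    List.TFAE [
      IsOctahedral Y,
      ∀ X : Submodule ℝ Y, IsClosed (X : Set Y) → TopologicalSpace.SeparableSpace X →
        IsAIIdeal X → IsOctahedral X,
      ∀ X : Submodule ℝ Y, IsClosed (X : Set Y) → ¬ ContainsCopyOfL1 (Y ⧸ X) →
        IsOctahedral X,
      ∀ X : Submodule ℝ Y, IsClosed (X : Set Y) → FiniteDimensional ℝ (Y ⧸ X) →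
        IsOctahedral X] := by
  tfae_have 1 → 2 := fun h X _ _ hX => h.of_isAIIdeal hX
  tfae_have 2 → 1 := fun h => isOctahedral_of_forall_finset_subset fun A => by
    obtain ⟨X, hAX, hX_closed, hX_sep, hX⟩ :=
      exists_separable_isAIIdeal (Submodule.span ℝ (A : Set Y)) A.countable_toSet.isSeparable.span
    exact ⟨X, Submodule.span_le.1 hAX, h X hX_closed hX_sep hX⟩
  tfae_have 1 → 3 := fun h X _ hX => h.of_not_containsCopyOfL1_quotient hX
  tfae_have 3 → 4 := fun h X hX_closed _ => h X hX_closed not_containsCopyOfL1_of_finiteDimensional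
  tfae_have 4 → 1 := fun h => isOctahedral_of_forall_finset_subset fun A =>
    ⟨⊤, Set.subset_univ _, h ⊤ isClosed_univ inferInstance⟩
  tfae_finish
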